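/- Let $H$ be a complex Hilbert space, let $P$ and $Q$ be (orthogonal) projections on $H$, and let $k\ge 0$ be an integer such that $P-Q$ belongs to the Schatten ideal $\mathcal B_{2k+1}$, i.e. $\operatorname{tr}|P-Q|^{2k+1}<\infty$. Then the operator $QP: PH\to QH$, $x\mapsto QPx$, is Fredholm, the operator $(P-Q)^{2k+1}$ is trace class, and $$\operatorname{Index}(QP:PH\to QH)=\operatorname{tr}\,(P-Q)^{2k+1},$$ where $\operatorname{Index}(T)=\dim\ker T-\dim\operatorname{coker} T$. -/

import Mathlib

open scoped InnerProductSpace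

noncomputable section

universe u

/-- The Schatten ideal `B_p` (for a natural number `p ≥ 1`): a bounded operator `T` on a complex
Hilbert space belongs to it if `|T| ^ p` has finite trace, where `|T| = (T* T)^(1/2)`. The diagonal
entries of the positive operator `|T| ^ p` are nonnegative reals, and the value of their sum is the
same in every orthonormal basis. -/
def MemSchatten {H : Type u} [NormedAddCommGroup H] [InnerProductSpace ℂ H] [CompleteSpace H]
    (p : ℕ) (T : H →L[ℂ] H) : Prop :=
  ∀ (ι : Type u) (b : HilbertBasis ι ℂ H),
    Summable fun i => RCLike.re ⟪b i, (CFC.abs T ^ p) (b i)⟫_ℂ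

/-- `HasTrace T t`: the operator `T` is trace class (i.e. belongs to `B_1`) and its trace is `t`,
that is, the diagonal entries of `T` in any orthonormal basis sum up to `t`. -/
def HasTrace {H : Type u} [NormedAddCommGroup H] [InnerProductSpace ℂ H] [CompleteSpace H]
    (T : H →L[ℂ] H) (t : ℂ) : Prop :=
  MemSchatten 1 T ∧
    ∀ (ι : Type u) (b : HilbertBasis ι ℂ H), HasSum (fun i => ⟪b i, T (b i)⟫_ℂ) t

/-- The operator `Q P : P H → Q H`, `x ↦ Q (P x)`. -/
def compressedProduct {H : Type u} [NormedAddCommGroup H] [InnerProductSpace ℂ H]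
    (Q P : H →L[ℂ] H) : P.range →L[ℂ] Q.range :=
  (Q ∘L P).restrict fun x _ => LinearMap.mem_range_self (Q : H →ₗ[ℂ] H) (P x)

end

/-!
Put `T = P - Q` and `C = 1 - P - Q`. Then `T` and `C` anticommute and
`C ^ 2 = 1 - T ^ 2`, so `C` maps the eigenspace of `T` for `μ` to the one for `-μ`, injectively if
`μ ≠ ±1`. Hence the multiplicities of `μ` and `-μ` agree for `μ ≠ 0, 1, -1`
(`finrank_eigenspace_sub_neg`), all these eigenvalues cancel in the trace of an odd power of `T`
(`eq_sub_of_hasSum_mul_pow_odd`), and what remains is the multiplicity of `1` minus that of `-1`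
(`hasTrace_sub_pow`). The two eigenspaces are `ran P ⊓ ker Q`, the kernel of `Q P : P H → Q H`, and
`ran Q ⊓ ker P`, which represents its cokernel.

The analysis behind this is as follows. The Schatten condition makes `T` compact
(`MemSchatten.isCompactOperator`): `|T| ^ (k + 1 / 2)` is Hilbert–Schmidt, so some power of `T` is
compact, and so is `T` itself, being self-adjoint. Therefore `H` has a Hilbert basis of eigenvectors
of `T` (`exists_hilbertBasis_eigenvectors`). In this basis the condition says that the powers
`|μ| ^ (2 k + 1)` are summable over the eigenvalues, which permits an exchange of summations that
computes the trace in any other basis (`HilbertBasis.hasSum_inner_apply_of_eigenbasis`). Finally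
`P Q P = (1 - T ^ 2) P` and `Q P Q = (1 - T ^ 2) Q`, where `T ^ 2` is compact and commutes with `P`
and `Q`; an inverse of `1 - T ^ 2` up to finite rank gives a quasi-inverse of `Q P`, which is
therefore Fredholm (`isFredholm_compressedProduct`).
-/

universe u

open Filter Topology
open Module (finrank)
open Module.End (eigenspace)

/-! ### Hilbert–Schmidt operators and compactness -/

section HilbertSchmidt

variable {H : Type*} [NormedAddCommGroup H] [InnerProductSpace ℂ H]

/-- Parseval's identity. -/
theorem HilbertBasis.hasSum_norm_inner_sq {ι : Type*} (b : HilbertBasis ι ℂ H) (x : H) :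
    HasSum (fun i => ‖⟪b i, x⟫_ℂ‖ ^ 2) (‖x‖ ^ 2) := by
  have h := (b.hasSum_inner_mul_inner x x).mapL Complex.reCLM
  rw [inner_self_eq_norm_sq_to_K] at h
  convert! h using 1
  · funext i
    rw [Complex.reCLM_apply, ← inner_conj_symm x (b i), ← Complex.normSq_eq_conj_mul_self,
      Complex.ofReal_re, Complex.normSq_eq_norm_sq]
  · simp [← Complex.ofReal_pow]

variable [CompleteSpace H]

/-- The adjoint of a Hilbert–Schmidt operator is compact. -/
theorem isCompactOperator_adjoint_of_summable_norm_sq {ι : Type*} (b : HilbertBasis ι ℂ H)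
    (A : H →L[ℂ] H) (hA : Summable fun i => ‖A (b i)‖ ^ 2) :
    IsCompactOperator (ContinuousLinearMap.adjoint A) := by
  classical
  -- `F s` is the adjoint followed by the projection onto the span of the `b i` with `i ∈ s`.
  let F : Finset ι → H →L[ℂ] H := fun s => ∑ i ∈ s, InnerProductSpace.rankOne ℂ (b i) (A (b i))
  have hF (s : Finset ι) (i : ι) (x : H) : ⟪b i, (ContinuousLinearMap.adjoint A - F s) x⟫_ℂ =
      if i ∈ s then 0 else ⟪A (b i), x⟫_ℂ := by
    have h1 : ⟪b i, F s x⟫_ℂ = if i ∈ s then ⟪A (b i), x⟫_ℂ else 0 := by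
      simp only [F, _root_.sum_apply, InnerProductSpace.rankOne_apply, inner_sum,
        inner_smul_right, orthonormal_iff_ite.mp b.orthonormal]
      simp
    rw [_root_.sub_apply, inner_sub_right, h1, ContinuousLinearMap.adjoint_inner_right]
    split_ifs <;> simp
  have hbound (s : Finset ι) : ‖F s - ContinuousLinearMap.adjoint A‖ ≤
      √(∑' i : {i // i ∉ s}, ‖A (b i)‖ ^ 2) := by
    rw [norm_sub_rev]
    refine ContinuousLinearMap.opNorm_le_bound _ (Real.sqrt_nonneg _) fun x => ?_
    refine le_of_sq_le_sq ?_ (by positivity)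
    rw [mul_pow, Real.sq_sqrt (tsum_nonneg fun _ => by positivity), ← tsum_mul_right,
      ← (b.hasSum_norm_inner_sq _).tsum_eq]
    have h2 : (fun i => ‖⟪b i, (ContinuousLinearMap.adjoint A - F s) x⟫_ℂ‖ ^ 2) =
        Set.indicator {i | i ∉ s} fun i => ‖⟪A (b i), x⟫_ℂ‖ ^ 2 := by
      funext i
      rw [hF]
      by_cases hi : i ∈ s <;> simp [hi]
    have h3 : Summable fun i : {i // i ∉ s} => ‖A (b i)‖ ^ 2 * ‖x‖ ^ 2 :=
      (hA.subtype _).mul_right _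
    have h4 (i : ι) : ‖⟪A (b i), x⟫_ℂ‖ ^ 2 ≤ ‖A (b i)‖ ^ 2 * ‖x‖ ^ 2 := by
      rw [← mul_pow]
      gcongr
      exact norm_inner_le_norm _ _
    rw [h2, ← tsum_subtype]
    exact Summable.tsum_le_tsum (fun i => h4 i)
      (.of_nonneg_of_le (fun _ => by positivity) (fun i => h4 i) h3) h3
  refine isCompactOperator_of_tendsto (l := atTop) (F := F) ?_ (Eventually.of_forall fun s => ?_)
  · rw [tendsto_iff_norm_sub_tendsto_zero]
    refine squeeze_zero (fun _ => norm_nonneg _) hbound ?_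
    simpa using (tendsto_tsum_compl_atTop_zero fun i => ‖A (b i)‖ ^ 2).sqrt
  · have hmem : F s ∈ compactOperator (RingHom.id ℂ) H H := by
      refine Submodule.sum_mem _ fun i _ => ?_
      exact IsCompactOperator.comp_clm (f := ContinuousLinearMap.toSpanSingleton ℂ (b i))
        (isCompactOperator_of_locallyCompactSpace_rng _) (innerSL ℂ (A (b i)))
    exact hmem

/-- `‖A x‖ ^ 2 ≤ ‖A ^ 2 x‖ * ‖x‖` for self-adjoint `A`, so `A` is as compact as its square. -/
theorem isCompactOperator_of_sq {A : H →L[ℂ] H} (hA : IsSelfAdjoint A)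
    (h : IsCompactOperator (A ^ 2 : H →L[ℂ] H)) : IsCompactOperator A := by
  have key (x : H) : ‖A x‖ ^ 2 ≤ ‖(A ^ 2) x‖ * ‖x‖ := by
    have h1 : ⟪A x, A x⟫_ℂ = ⟪(A ^ 2) x, x⟫_ℂ := by
      rw [sq, mul_apply_eq_comp]
      exact (hA.isSymmetric (A x) x).symm
    rw [inner_self_eq_norm_sq_to_K] at h1
    have h2 := congrArg norm h1
    simp only [norm_pow, Complex.coe_algebraMap, Complex.norm_real, norm_norm] at h2
    rw [h2]
    exact norm_inner_le_norm _ _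
  have h' := (isCompactOperator_iff_isCompact_closure_image_closedBall
    ((A ^ 2 : H →L[ℂ] H) : H →ₗ[ℂ] H) zero_lt_one).mp h
  refine (isCompactOperator_iff_isCompact_closure_image_closedBall
    (A : H →ₗ[ℂ] H) zero_lt_one).mpr ?_
  refine TotallyBounded.isCompact_of_isClosed (TotallyBounded.closure ?_) isClosed_closure
  have h3 := h'.totallyBounded.subset subset_closure
  rw [Metric.totallyBounded_iff]
  intro ε hε
  obtain ⟨t, hts, htf, ht⟩ := Metric.finite_approx_of_totallyBounded h3 (ε ^ 2 / 2) (by positivity)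
  have hts' (y : H) (hy : y ∈ t) : ∃ x ∈ Metric.closedBall (0 : H) 1, (A ^ 2) x = y := hts hy
  choose! g hg using hts'
  refine ⟨(fun y => A (g y)) '' t, htf.image _, ?_⟩
  rintro _ ⟨x, hx, rfl⟩
  obtain ⟨y, hy, hxy⟩ := Set.mem_iUnion₂.mp (ht ⟨x, hx, rfl⟩)
  refine Set.mem_iUnion₂.mpr ⟨_, ⟨y, hy, rfl⟩, ?_⟩
  have hgy := hg y hy
  rw [← hgy.2] at hxy
  simp only [Metric.mem_ball, dist_eq_norm, ContinuousLinearMap.coe_coe, ← map_sub] at hxy ⊢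
  have h4 := key (x - g y)
  have h5 : ‖x - g y‖ ≤ 2 := by
    have h6 := hgy.1
    simp only [Metric.mem_closedBall, dist_zero_right] at hx h6
    linarith [norm_sub_le x (g y)]
  refine lt_of_pow_lt_pow_left₀ 2 hε.le ?_
  calc ‖A (x - g y)‖ ^ 2 ≤ ‖(A ^ 2) (x - g y)‖ * ‖x - g y‖ := h4
    _ ≤ ‖(A ^ 2) (x - g y)‖ * 2 := by gcongr
    _ < ε ^ 2 / 2 * 2 := by gcongr
    _ = ε ^ 2 := by ring

theorem isCompactOperator_of_two_pow {A : H →L[ℂ] H} (hA : IsSelfAdjoint A) (m : ℕ)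
    (h : IsCompactOperator (A ^ 2 ^ m : H →L[ℂ] H)) : IsCompactOperator A := by
  induction m with
  | zero => simpa using h
  | succ m ih => exact ih (isCompactOperator_of_sq (hA.pow _) (by rwa [← pow_mul, ← pow_succ]))

end HilbertSchmidt

/-! ### Operators in an odd Schatten ideal -/

section Schatten

variable {H : Type u} [NormedAddCommGroup H] [InnerProductSpace ℂ H] [CompleteSpace H]

/-- A self-adjoint operator in an odd Schatten ideal is compact: with `S = |T|`, the operator
`S ^ (1 / 2) * S ^ k` is Hilbert–Schmidt. -/
theorem MemSchatten.isCompactOperator {T : H →L[ℂ] H} (hT : IsSelfAdjoint T) {k : ℕ}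
    (h : MemSchatten (2 * k + 1) T) : IsCompactOperator T := by
  obtain ⟨w, b, -⟩ := exists_hilbertBasis ℂ H
  set S := CFC.abs T with hS
  have hS0 : 0 ≤ S := CFC.abs_nonneg T
  set R := CFC.sqrt S with hR
  have hRR : R * R = S := CFC.sqrt_mul_sqrt_self S
  have hRsa : IsSelfAdjoint R := (CFC.sqrt_nonneg S).isSelfAdjoint
  have hSsa : IsSelfAdjoint S := hS0.isSelfAdjoint
  have hsum : Summable fun i => ‖(R * S ^ k) (b i)‖ ^ 2 := by
    refine (h w b).congr fun i => ?_
    have h1 : S ^ (2 * k + 1) = S ^ k * (R * (R * S ^ k)) := by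
      rw [← mul_assoc R, hRR, ← pow_succ', ← pow_add]
      congr 1
      ring
    rw [h1, ← inner_self_eq_norm_sq (𝕜 := ℂ)]
    congr 1
    exact ((hSsa.pow k).isSymmetric _ _).symm.trans (hRsa.isSymmetric _ _).symm
  have hcomp := isCompactOperator_adjoint_of_summable_norm_sq b _ hsum
  rw [← ContinuousLinearMap.star_eq_adjoint, star_mul, hRsa.star_eq, (hSsa.pow k).star_eq] at hcomp
  have hS1 : IsCompactOperator (S ^ (k + 1) : H →L[ℂ] H) := by
    have : S ^ (k + 1) = S ^ k * R * R := by rw [mul_assoc, hRR, pow_succ]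
    rw [this]
    exact hcomp.comp_clm R
  refine isCompactOperator_of_two_pow hT (k + 1) ?_
  have hST : S ^ 2 = T ^ 2 := by rw [CFC.abs_sq, hT.star_eq, sq]
  have hle : k + 1 ≤ 2 ^ (k + 1) := Nat.lt_two_pow_self.le
  have : T ^ 2 ^ (k + 1) = S ^ (k + 1) * S ^ (2 ^ (k + 1) - (k + 1)) := by
    rw [← pow_add, Nat.add_sub_cancel' hle, pow_succ', pow_mul, pow_mul, hST]
  rw [this]
  exact hS1.comp_clm _

theorem MemSchatten.pow {T : H →L[ℂ] H} (hT : IsSelfAdjoint T) {p : ℕ}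
    (h : MemSchatten p T) : MemSchatten 1 (T ^ p) := by
  have : CFC.abs (T ^ p) = CFC.abs T ^ p := by
    clear h
    induction p with
    | zero => simp
    | succ p ih =>
      have hc : Commute (T ^ p) T := (Commute.refl T).pow_left p
      rw [pow_succ, pow_succ, hc.cfcAbs_mul_eq (by rwa [hT.star_eq]), ih]
  intro ι b
  rw [pow_one, this]
  exact h ι b

theorem abs_apply_of_apply_eq_smul {T : H →L[ℂ] H} (hT : IsSelfAdjoint T) {x : H} {μ : ℂ}
    (hx : T x = μ • x) : CFC.abs T x = (‖μ‖ : ℂ) • x := by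
  rcases eq_or_ne x 0 with rfl | hx0
  · simp
  have hμ : (starRingEnd ℂ) μ = μ := hT.isSymmetric.conj_eigenvalue_eq_self
    (Module.End.hasEigenvalue_of_hasEigenvector ⟨Module.End.mem_eigenspace_iff.mpr hx, hx0⟩)
  set S := CFC.abs T with hS
  have hS0 : S.IsPositive := S.nonneg_iff_isPositive.mp (CFC.abs_nonneg T)
  have hSS : S (S x) = ((‖μ‖ : ℂ) * ‖μ‖) • x := by
    have h1 : S (S x) = T (T x) := by
      rw [← mul_apply_eq_comp, ← mul_apply_eq_comp,
        CFC.abs_mul_abs, hT.star_eq]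
    rw [h1, hx, map_smul, hx, smul_smul, ← sq, ← sq, ← Complex.mul_conj', hμ, sq]
  -- `y` is an eigenvector of the positive operator `|T|` for the nonpositive value `-‖μ‖`.
  set y := S x - (‖μ‖ : ℂ) • x with hy
  have hSy : S y = (-‖μ‖ : ℂ) • y := by
    rw [hy, map_sub, map_smul, hSS, smul_sub, smul_smul]
    module
  have h2 := hS0.re_inner_nonneg_right y
  rw [hSy, inner_smul_right, inner_self_eq_norm_sq_to_K] at h2
  have h3 : 0 ≤ -‖μ‖ * ‖y‖ ^ 2 := by
    convert! h2 using 1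
    simp [← Complex.ofReal_pow, ← Complex.ofReal_mul, ← Complex.ofReal_neg]
  rcases (norm_nonneg μ).eq_or_lt with h0 | h0
  · rw [← h0] at hSS hy ⊢
    have h4 : ⟪S x, S x⟫_ℂ = ⟪S (S x), x⟫_ℂ := (hS0.isSymmetric (S x) x).symm
    rw [hSS] at h4
    simpa using h4
  · have h5 : ‖y‖ ^ 2 = 0 := by nlinarith [sq_nonneg ‖y‖]
    simpa [hy, sub_eq_zero] using h5

end Schatten

/-! ### Traces of diagonalizable operators -/

section Trace

variable {H : Type*} [NormedAddCommGroup H] [InnerProductSpace ℂ H]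

/-- If an operator is diagonal in some Hilbert basis, with absolutely summable eigenvalues, then its
diagonal entries in any other Hilbert basis sum up to the sum of the eigenvalues. -/
theorem HilbertBasis.hasSum_inner_apply_of_eigenbasis {ι κ : Type*} (e : HilbertBasis ι ℂ H)
    {A : H →L[ℂ] H} {c : ι → ℂ} (hA : ∀ j, A (e j) = c j • e j) (hc : Summable fun j => ‖c j‖)
    (b : HilbertBasis κ ℂ H) : HasSum (fun i => ⟪b i, A (b i)⟫_ℂ) (∑' j, c j) := by
  let F : ι × κ → ℂ := fun q => c q.1 * (‖⟪e q.1, b q.2⟫_ℂ‖ ^ 2 : ℝ)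
  have hnorm (q : ι × κ) : ‖F q‖ = ‖c q.1‖ * ‖⟪e q.1, b q.2⟫_ℂ‖ ^ 2 := by
    simp [F]
  have hone (j : ι) : HasSum (fun i => ‖⟪e j, b i⟫_ℂ‖ ^ 2) 1 := by
    simpa [norm_inner_symm (e j), e.orthonormal.1 j] using b.hasSum_norm_inner_sq (e j)
  have hFs : Summable F := by
    refine Summable.of_norm ((summable_prod_of_nonneg fun _ => norm_nonneg _).mpr ⟨fun j => ?_, ?_⟩)
    · simp only [hnorm]
      exact (hone j).summable.mul_left _
    · simpa only [hnorm, ((hone _).mul_left _).tsum_eq, mul_one] using hc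
  have hrow (j : ι) : HasSum (fun i => F (j, i)) (c j) := by
    simpa [F] using ((hone j).mapL Complex.ofRealCLM).mul_left (c j)
  have hcol (i : κ) : HasSum (fun j => F (j, i)) ⟪b i, A (b i)⟫_ℂ := by
    have h := (e.hasSum_repr (b i)).mapL (innerSL ℂ (b i) ∘L A)
    convert! h using 1
    funext j
    simp only [F, ContinuousLinearMap.comp_apply, map_smul, hA, innerSL_apply_apply, smul_eq_mul,
      e.repr_apply_apply]
    rw [← inner_conj_symm (b i) (e j), mul_left_comm, Complex.mul_conj, Complex.normSq_eq_norm_sq]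
  rw [(hFs.hasSum.prod_fiberwise hrow).tsum_eq]
  exact ((Equiv.prodComm κ ι).hasSum_iff.mpr hFs.hasSum).prod_fiberwise hcol

end Trace

/-! ### Eigenbases of compact self-adjoint operators -/

section Eigenbasis

variable {H : Type u} [NormedAddCommGroup H] [InnerProductSpace ℂ H] [CompleteSpace H]

/-- A compact self-adjoint operator has a Hilbert basis of eigenvectors, grouped by eigenvalue. -/
theorem exists_hilbertBasis_eigenvectors {T : H →L[ℂ] H} (hT : IsSelfAdjoint T)
    (hc : IsCompactOperator T) :
    ∃ (ι : ℂ → Type u) (e : HilbertBasis (Σ μ, ι μ) ℂ H), (∀ j, T (e j) = j.1 • e j) ∧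
      ∀ μ ≠ 0, Finite (ι μ) ∧ Nat.card (ι μ) = finrank ℂ (eigenspace (T : H →ₗ[ℂ] H) μ) := by
  have hcl (μ : ℂ) : IsClosed (eigenspace (T : H →ₗ[ℂ] H) μ : Set H) := by
    have : eigenspace (T : H →ₗ[ℂ] H) μ = (T - μ • ContinuousLinearMap.id ℂ H).ker := by
      ext x
      simp [sub_eq_zero]
    rw [this]
    exact ContinuousLinearMap.isClosed_ker _
  have (μ : ℂ) : CompleteSpace (eigenspace (T : H →ₗ[ℂ] H) μ) := (hcl μ).completeSpace_coe
  choose w b hb using fun μ : ℂ => exists_hilbertBasis ℂ (eigenspace (T : H →ₗ[ℂ] H) μ)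
  have horth : Orthonormal ℂ fun a : Σ μ, w μ => ((b a.1 a.2 : _) : H) :=
    hT.isSymmetric.orthogonalFamily_eigenspaces.orthonormal_sigma_orthonormal
      fun μ => (b μ).orthonormal
  have htot : (Submodule.span ℂ (Set.range fun a : Σ μ, w μ => ((b a.1 a.2 : _) : H)))ᗮ = ⊥ := by
    rw [eq_bot_iff, ← ContinuousLinearMap.orthogonalComplement_iSup_eigenspaces_eq_bot hc
      hT.isSymmetric]
    intro x hx
    rw [← Submodule.iInf_orthogonal, Submodule.mem_iInf]
    intro μ y hy
    have h := ((b μ).hasSum_repr ⟨y, hy⟩).mapL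
      (innerSL ℂ x ∘L (eigenspace (T : H →ₗ[ℂ] H) μ).subtypeL)
    have h0 (i : w μ) : ⟪x, (b μ i : H)⟫_ℂ = 0 :=
      inner_eq_zero_symm.mp (hx _ (Submodule.subset_span ⟨⟨μ, i⟩, rfl⟩))
    have h1 : HasSum (fun _ : w μ => (0 : ℂ)) ⟪x, y⟫_ℂ := by
      convert! h using 1
      funext i
      simp [h0]
    exact inner_eq_zero_symm.mp (h1.unique hasSum_zero)
  refine ⟨fun μ => w μ, HilbertBasis.mkOfOrthogonalEqBot horth htot, fun j => ?_, fun μ hμ => ?_⟩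
  · rw [HilbertBasis.coe_mkOfOrthogonalEqBot]
    exact Module.End.mem_eigenspace_iff.mp (b j.1 j.2).2
  · have := ContinuousLinearMap.finite_dimensional_eigenspace hc μ hμ
    have : Finite (w μ) := (b μ).orthonormal.linearIndependent.finite
    have := Fintype.ofFinite (w μ)
    exact ⟨inferInstance, by
      rw [Nat.card_eq_fintype_card, Module.finrank_eq_card_basis (b μ).toOrthonormalBasis.toBasis]⟩

end Eigenbasis

/-- An odd power sum over a multiset of numbers that is symmetric about `0`, except for the numbers
`1` and `-1`, only sees these two. -/
theorem eq_sub_of_hasSum_mul_pow_odd {n : ℂ → ℕ} {p : ℕ} (hp : Odd p) {t : ℂ}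
    (h : HasSum (fun μ : ℂ => (n μ : ℂ) * μ ^ p) t)
    (hn : ∀ μ, μ ≠ 0 → μ ≠ 1 → μ ≠ -1 → n (-μ) = n μ) : t = n 1 - n (-1) := by
  have h1 : HasSum (fun μ : ℂ => if μ = 1 then (n 1 : ℂ) else 0) (n 1) := hasSum_ite_eq _ _
  have h2 : HasSum (fun μ : ℂ => if μ = -1 then (n (-1) : ℂ) else 0) (n (-1)) := hasSum_ite_eq _ _
  have h3 := (h.sub h1).add h2
  -- After removing `±1`, the summand is an odd function, so its sum equals its own negative.
  have h4 := (Equiv.neg ℂ).hasSum_iff.mpr h3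
  have h5 := h3.neg
  have h6 := h4.unique (by
    convert! h5 using 1
    funext μ
    simp only [Function.comp_apply, Equiv.neg_apply, hp.neg_pow]
    by_cases hμ1 : μ = 1
    · subst hμ1
      norm_num
    by_cases hμ2 : μ = -1
    · subst hμ2
      norm_num [hp.neg_pow]
    have : -μ ≠ 1 := fun h => hμ2 (by rw [← h, neg_neg])
    have : -μ ≠ -1 := fun h => hμ1 (neg_injective h)
    by_cases hμ0 : μ = 0
    · subst hμ0
      simp [hp.pos.ne']
    simp [*])
  linear_combination h6 / 2

/-! ### Pairs of projections -/

section Projections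

theorem eigenspace_sub_neg_one {H : Type*} [NormedAddCommGroup H] [InnerProductSpace ℂ H]
    (P Q : H →L[ℂ] H) :
    eigenspace ((P - Q : H →L[ℂ] H) : H →ₗ[ℂ] H) (-1) =
      eigenspace ((Q - P : H →L[ℂ] H) : H →ₗ[ℂ] H) 1 := by
  ext x
  simp only [Module.End.mem_eigenspace_iff, ContinuousLinearMap.coe_coe, _root_.sub_apply,
    one_smul, neg_smul]
  rw [← neg_inj, neg_neg, neg_sub]

variable {H : Type*} [NormedAddCommGroup H] [InnerProductSpace ℂ H] [CompleteSpace H]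
  {P Q : H →L[ℂ] H}

theorem IsStarProjection.apply_apply (hP : IsStarProjection P) (x : H) : P (P x) = P x :=
  congrArg (fun A : H →L[ℂ] H => A x) hP.isIdempotentElem.eq

theorem IsStarProjection.inner_apply_left (hP : IsStarProjection P) (x y : H) :
    ⟪P x, y⟫_ℂ = ⟪x, P y⟫_ℂ :=
  hP.isSelfAdjoint.isSymmetric x y

theorem IsStarProjection.mem_range_iff (hP : IsStarProjection P) {x : H} :
    x ∈ P.range ↔ P x = x :=
  ⟨by rintro ⟨y, rfl⟩; exact hP.apply_apply y, fun h => ⟨x, h⟩⟩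

/-- The eigenspace of `P - Q` for `1` is `ran P ⊓ ker Q`. -/
theorem mem_eigenspace_sub_one_iff (hP : IsStarProjection P) (hQ : IsStarProjection Q) {x : H} :
    x ∈ eigenspace ((P - Q : H →L[ℂ] H) : H →ₗ[ℂ] H) 1 ↔ P x = x ∧ Q x = 0 := by
  rw [Module.End.mem_eigenspace_iff]
  constructor
  · intro h
    have h : P x - Q x = x := by simpa using h
    have h2 : x - P x = - Q x := by rw [eq_neg_iff_add_eq_zero]; nth_rw 1 [← h]; abel
    -- `Q (P x) = 2 • Q x` by applying `Q` to `P x - Q x = x`, and `P x` is orthogonal to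
    -- `x - P x = -Q x`, so `0 = ⟪P x, Q x⟫ = 2 * ‖Q x‖ ^ 2`.
    have h3 : Q x = 0 := by
      have h4 : ⟪P x, x - P x⟫_ℂ = 0 := by
        rw [hP.inner_apply_left, map_sub, hP.apply_apply, sub_self, inner_zero_right]
      have h5 : Q (P x) = Q x + Q x := by
        nth_rw 2 [← h]
        rw [map_sub, hQ.apply_apply]
        abel
      rw [h2, inner_neg_right, neg_eq_zero, ← hQ.inner_apply_left, h5] at h4
      have h6 : ⟪Q x, x⟫_ℂ = 0 := by
        rw [inner_add_left, ← two_mul] at h4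
        simpa using h4
      rw [← hQ.apply_apply x, hQ.inner_apply_left] at h6
      exact inner_self_eq_zero.mp h6
    exact ⟨by simpa [h3] using h, h3⟩
  · rintro ⟨h1, h2⟩
    simp [h1, h2]

/-- The operator `1 - P - Q` anticommutes with `P - Q`, and its square is `1 - (P - Q) ^ 2`. So it
embeds the eigenspace for `μ` into the one for `-μ` unless `μ = ±1`. -/
theorem finrank_eigenspace_sub_le (hP : IsStarProjection P) (hQ : IsStarProjection Q)
    (hc : IsCompactOperator (P - Q)) {μ : ℂ} (h0 : μ ≠ 0) (h1 : μ ≠ 1) (h2 : μ ≠ -1) :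
    finrank ℂ (eigenspace ((P - Q : H →L[ℂ] H) : H →ₗ[ℂ] H) μ) ≤
      finrank ℂ (eigenspace ((P - Q : H →L[ℂ] H) : H →ₗ[ℂ] H) (-μ)) := by
  have := ContinuousLinearMap.finite_dimensional_eigenspace hc (-μ) (neg_ne_zero.mpr h0)
  have hanti : (P - Q) * (1 - P - Q) = -((1 - P - Q) * (P - Q)) := by
    have := hP.isIdempotentElem.eq
    have := hQ.isIdempotentElem.eq
    simp only [mul_sub, sub_mul, mul_one, one_mul, *]
    abel
  have hsq : (1 - P - Q) * (1 - P - Q) = 1 - (P - Q) * (P - Q) := by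
    have := hP.isIdempotentElem.eq
    have := hQ.isIdempotentElem.eq
    simp only [mul_sub, sub_mul, mul_one, one_mul, *]
    abel
  have hmaps : ∀ x ∈ eigenspace ((P - Q : H →L[ℂ] H) : H →ₗ[ℂ] H) μ,
      (1 - P - Q) x ∈ eigenspace ((P - Q : H →L[ℂ] H) : H →ₗ[ℂ] H) (-μ) := by
    intro x hx
    have hx : (P - Q) x = μ • x := Module.End.mem_eigenspace_iff.mp hx
    refine Module.End.mem_eigenspace_iff.mpr ?_
    have := congrArg (fun A : H →L[ℂ] H => A x) hanti
    change (P - Q) ((1 - P - Q) x) = -((1 - P - Q) ((P - Q) x)) at this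
    rw [hx, map_smul, ← neg_smul] at this
    exact this
  refine LinearMap.finrank_le_finrank_of_injective
    (f := ((1 - P - Q : H →L[ℂ] H) : H →ₗ[ℂ] H).restrict hmaps) ?_
  rw [injective_iff_map_eq_zero]
  rintro ⟨x, hx⟩ hx0
  have hx : (P - Q) x = μ • x := Module.End.mem_eigenspace_iff.mp hx
  have hx0 : (1 - P - Q) x = 0 := congrArg Subtype.val hx0
  have h3 := congrArg (fun A : H →L[ℂ] H => A x) hsq
  change (1 - P - Q) ((1 - P - Q) x) = x - (P - Q) ((P - Q) x) at h3
  rw [hx0, map_zero, hx, map_smul, hx, smul_smul] at h3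
  have h4 : (1 - μ * μ) • x = 0 := by rw [sub_smul, one_smul, ← h3]
  have h5 : 1 - μ * μ ≠ 0 := by
    intro h
    have : (μ - 1) * (μ + 1) = 0 := by linear_combination -h
    rcases mul_eq_zero.mp this with h | h
    · exact h1 (sub_eq_zero.mp h)
    · exact h2 (eq_neg_of_add_eq_zero_left h)
  exact Subtype.ext ((smul_eq_zero.mp h4).resolve_left h5)

theorem finrank_eigenspace_sub_neg (hP : IsStarProjection P) (hQ : IsStarProjection Q)
    (hc : IsCompactOperator (P - Q)) {μ : ℂ} (h0 : μ ≠ 0) (h1 : μ ≠ 1) (h2 : μ ≠ -1) :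
    finrank ℂ (eigenspace ((P - Q : H →L[ℂ] H) : H →ₗ[ℂ] H) (-μ)) =
      finrank ℂ (eigenspace ((P - Q : H →L[ℂ] H) : H →ₗ[ℂ] H) μ) := by
  refine le_antisymm ?_ (finrank_eigenspace_sub_le hP hQ hc h0 h1 h2)
  have := finrank_eigenspace_sub_le hP hQ hc (neg_ne_zero.mpr h0)
    (fun h => h2 (by rw [← h, neg_neg])) (fun h => h1 (neg_injective h))
  rwa [neg_neg] at this

theorem finrank_ker_compressedProduct (hP : IsStarProjection P) (hQ : IsStarProjection Q) :
    finrank ℂ (compressedProduct Q P).toLinearMap.ker =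
      finrank ℂ (eigenspace ((P - Q : H →L[ℂ] H) : H →ₗ[ℂ] H) 1) := by
  have h : (compressedProduct Q P).toLinearMap.ker.map P.range.subtype =
      eigenspace ((P - Q : H →L[ℂ] H) : H →ₗ[ℂ] H) 1 := by
    ext x
    rw [mem_eigenspace_sub_one_iff hP hQ, Submodule.mem_map]
    constructor
    · rintro ⟨⟨y, hy⟩, hy0, rfl⟩
      have hy1 := hP.mem_range_iff.mp hy
      have hy2 : Q (P y) = 0 := congrArg Subtype.val (LinearMap.mem_ker.mp hy0)
      exact ⟨hy1, by rwa [hy1] at hy2⟩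
    · rintro ⟨h1, h2⟩
      refine ⟨⟨x, hP.mem_range_iff.mpr h1⟩, ?_, rfl⟩
      exact LinearMap.mem_ker.mpr (Subtype.ext (show Q (P x) = 0 by rw [h1, h2]))
  rw [← h]
  exact (Submodule.equivMapOfInjective _ P.range.injective_subtype _).finrank_eq

/-- The cokernel of `Q P : P H → Q H` is the orthogonal complement of its closed range, which is
`ran Q ⊓ ker P`. -/
theorem finrank_coker_compressedProduct (hP : IsStarProjection P) (hQ : IsStarProjection Q)
    (hcl : IsClosed ((compressedProduct Q P).range : Set Q.range)) :
    finrank ℂ (Q.range ⧸ (compressedProduct Q P).toLinearMap.range) =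
      finrank ℂ (eigenspace ((P - Q : H →L[ℂ] H) : H →ₗ[ℂ] H) (-1)) := by
  have : CompleteSpace Q.range :=
    (ContinuousLinearMap.IsIdempotentElem.isClosed_range hQ.isIdempotentElem).completeSpace_coe
  have : CompleteSpace (compressedProduct Q P).toLinearMap.range := hcl.completeSpace_coe
  have h : ((compressedProduct Q P).toLinearMap.rangeᗮ).map Q.range.subtype =
      eigenspace ((P - Q : H →L[ℂ] H) : H →ₗ[ℂ] H) (-1) := by
    ext y
    rw [eigenspace_sub_neg_one, mem_eigenspace_sub_one_iff hQ hP, Submodule.mem_map]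
    constructor
    · rintro ⟨⟨y, hy⟩, hy0, rfl⟩
      have hy1 := hQ.mem_range_iff.mp hy
      refine ⟨hy1, ?_⟩
      have h2 : ⟪Q (P (P y)), y⟫_ℂ = 0 :=
        hy0 _ ⟨⟨P y, LinearMap.mem_range_self (P : H →ₗ[ℂ] H) y⟩, rfl⟩
      rw [hQ.inner_apply_left, hy1, hP.inner_apply_left] at h2
      exact inner_self_eq_zero.mp h2
    · rintro ⟨h1, h2⟩
      refine ⟨⟨y, hQ.mem_range_iff.mpr h1⟩, ?_, rfl⟩
      rintro _ ⟨⟨x, hx⟩, rfl⟩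
      change ⟪Q (P x), y⟫_ℂ = 0
      rw [hQ.inner_apply_left, h1, hP.inner_apply_left, h2, inner_zero_right]
  rw [← h, (Submodule.quotientEquivOfIsCompl _ _
    (Submodule.isCompl_orthogonal
      (compressedProduct Q P).toLinearMap.range)).finrank_eq]
  exact (Submodule.equivMapOfInjective _ Q.range.injective_subtype _).finrank_eq

/-- A symmetric operator commutes with the projection onto an invariant subspace. -/
theorem commute_starProjection {A : H →L[ℂ] H} (hA : IsSelfAdjoint A) {E : Submodule ℂ H}
    [E.HasOrthogonalProjection] (hE : ∀ x ∈ E, A x ∈ E) : Commute E.starProjection A := by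
  have h1 : E.starProjection * (A * E.starProjection) = A * E.starProjection := by
    ext x
    exact Submodule.starProjection_eq_self_iff.mpr (hE _ (E.starProjection_apply_mem x))
  have h2 := congrArg star h1
  have h3 : star E.starProjection = E.starProjection := isSelfAdjoint_starProjection E
  simp only [star_mul, h3, hA.star_eq] at h2
  exact h2.symm.trans ((mul_assoc _ _ _).trans h1)

/-- For `K` compact and self-adjoint, `1 - K` becomes invertible after adding the projection onto
its (finite-dimensional) kernel. -/
theorem exists_inverse_one_sub_add_starProjection {K : H →L[ℂ] H} (hK : IsSelfAdjoint K)
    (hc : IsCompactOperator K) (E : Submodule ℂ H) [FiniteDimensional ℂ E]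
    (hE : ∀ x, x ∈ E ↔ K x = x) :
    ∃ R : H →L[ℂ] H, R * (1 - K + E.starProjection) = 1 ∧ (1 - K + E.starProjection) * R = 1 := by
  have hKE : Commute E.starProjection K :=
    commute_starProjection hK fun x hx => by rwa [(hE x).mp hx]
  have hc' : IsCompactOperator (K - E.starProjection) := by
    refine hc.sub ?_
    exact IsCompactOperator.clm_comp (f := E.orthogonalProjectionOnto)
      (isCompactOperator_of_locallyCompactSpace_dom _) E.subtypeL
  have hun : IsUnit (1 - K + E.starProjection) := by
    rcases hc'.hasEigenvalue_or_mem_resolventSet one_ne_zero with h | h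
    · obtain ⟨x, hx, hx0⟩ := h.exists_hasEigenvector
      have hx : K x - E.starProjection x = x := by
        simpa using Module.End.mem_eigenspace_iff.mp hx
      have h1 : E.starProjection (K x) = E.starProjection x := by
        have : K (E.starProjection x) = E.starProjection x :=
          (hE _).mp (E.starProjection_apply_mem x)
        rw [← this]
        exact congrArg (fun A : H →L[ℂ] H => A x) hKE.eq
      have h2 : E.starProjection x = 0 := by
        have h3 := congrArg E.starProjection hx
        rw [map_sub, h1, Submodule.starProjection_eq_self_iff.mpr (E.starProjection_apply_mem x),
          sub_self] at h3
        exact h3.symm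
      rw [h2, sub_zero] at hx
      exact absurd (h2.symm.trans (Submodule.starProjection_eq_self_iff.mpr ((hE x).mpr hx))).symm hx0
    · rw [spectrum.mem_resolventSet_iff, map_one] at h
      rwa [sub_sub_eq_add_sub, add_sub_right_comm] at h
  obtain ⟨U, hU⟩ := hun
  exact ⟨↑U⁻¹, by rw [← hU, U.inv_mul], by rw [← hU, U.mul_inv]⟩

open scoped LinearMap.FiniteRangeSetoid in
/-- With `D = (P - Q) ^ 2`, which commutes with `P` and `Q`, one has `P Q P = (1 - D) P` and
`Q P Q = (1 - D) Q`; so an inverse of `1 - D` up to finite rank yields a quasi-inverse of `Q P`. -/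
theorem isFredholm_compressedProduct (hP : IsStarProjection P) (hQ : IsStarProjection Q)
    (hc : IsCompactOperator (P - Q)) : (compressedProduct Q P).IsFredholm := by
  have hPP := hP.isIdempotentElem.eq
  have hQQ := hQ.isIdempotentElem.eq
  set D := (P - Q) * (P - Q) with hD
  have hTsa : IsSelfAdjoint (P - Q) := hP.isSelfAdjoint.sub hQ.isSelfAdjoint
  have hDsa : IsSelfAdjoint D := by rw [hD, ← sq]; exact hTsa.pow 2
  have hDc : IsCompactOperator D := hc.comp_clm (P - Q)
  have hDP : P * D = D * P := by
    simp only [hD, mul_sub, sub_mul, ← mul_assoc, hPP]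
    simp only [mul_assoc, hPP, hQQ]
    abel
  have hDQ : Q * D = D * Q := by
    simp only [hD, mul_sub, sub_mul, ← mul_assoc, hQQ]
    simp only [mul_assoc, hPP, hQQ]
    abel
  have hPQP : P * (Q * P) = (1 - D) * P := by
    simp only [hD, mul_sub, sub_mul, one_mul, mul_assoc, hPP]
    simp only [← mul_assoc, hQQ]
    abel
  have hQPQ : Q * (P * Q) = (1 - D) * Q := by
    simp only [hD, mul_sub, sub_mul, one_mul, mul_assoc, hQQ]
    simp only [← mul_assoc, hPP]
    abel
  let E := eigenspace (D : H →ₗ[ℂ] H) 1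
  have hE (x : H) : x ∈ E ↔ D x = x := by simp [E]
  have : FiniteDimensional ℂ E :=
    ContinuousLinearMap.finite_dimensional_eigenspace hDc 1 one_ne_zero
  obtain ⟨R, hR1, hR2⟩ := exists_inverse_one_sub_add_starProjection hDsa hDc E hE
  set N := E.starProjection with hN
  -- `R` commutes with every self-adjoint operator that commutes with `D`.
  have hRA (A : H →L[ℂ] H) (hA : IsSelfAdjoint A) (hAD : A * D = D * A) : R * A = A * R := by
    have h1 : Commute N A := commute_starProjection hA fun x hx => by
      rw [hE] at hx ⊢
      have := congrArg (fun B : H →L[ℂ] H => B x) hAD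
      change A (D x) = D (A x) at this
      rw [← this, hx]
    have h2 : A * (1 - D + N) = (1 - D + N) * A := by
      simp only [mul_add, mul_sub, add_mul, sub_mul, mul_one, one_mul, hAD, h1.eq]
    calc R * A = R * (A * (1 - D + N)) * R := by rw [mul_assoc, mul_assoc, hR2, mul_one]
      _ = A * R := by rw [h2, ← mul_assoc, hR1, one_mul]
  have hRP := hRA P hP.isSelfAdjoint hDP
  have hRQ := hRA Q hQ.isSelfAdjoint hDQ
  have hRD : R * (1 - D) = 1 - R * N := by
    rw [eq_sub_iff_add_eq, ← mul_add, hR1]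
  have hmem (x : H) : (R * P * Q) x ∈ P.range := by
    rw [hRP, mul_assoc]
    exact LinearMap.mem_range_self (P : H →ₗ[ℂ] H) ((R * Q) x)
  let v : Q.range →L[ℂ] P.range := ((R * P * Q).comp Q.range.subtypeL).codRestrict P.range
    fun x => hmem x
  -- An operator into a subspace has finite rank as soon as it factors through `N` in `H`.
  have hfin (X Y : Submodule ℂ H) (f : X →ₗ[ℂ] Y) (hf : ∀ x : X, (f x : H) = -(R (N x))) :
      f.HasNoetherianRange := by
    have h1 : (Y.subtype ∘ₗ f).HasNoetherianRange := by
      have : Y.subtype ∘ₗ f = (-(R : H →ₗ[ℂ] H) ∘ₗ E.subtype) ∘ₗ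
          ((E.orthogonalProjectionOnto : H →ₗ[ℂ] E) ∘ₗ X.subtype) := by
        ext x
        exact hf x
      rw [this]
      exact (LinearMap.HasNoetherianRange.of_isNoetherian_dom).comp_right _
    rw [LinearMap.HasNoetherianRange, LinearMap.range_comp] at h1
    exact isNoetherian_of_linearEquiv
      (Submodule.equivMapOfInjective _ Y.injective_subtype f.range).symm
  refine ContinuousLinearMap.IsFredholm.of_isQuasiInverse (v := v) ⟨?_, ?_⟩
  · refine LinearMap.FiniteRangeSetoid.equiv_iff_hasNoetherianRange.mpr (hfin _ _ _ ?_)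
    rintro ⟨x, hx⟩
    have hx := hP.mem_range_iff.mp hx
    have h1 : R * P * Q * (Q * P) = (1 - R * N) * P := by
      rw [← hRD, mul_assoc R, mul_assoc R, mul_assoc R, ← hPQP, mul_assoc P, ← mul_assoc Q Q, hQQ]
    have h2 := congrArg (fun B : H →L[ℂ] H => B x) h1
    change (R * P * Q) ((Q * P) x) = P x - R (N (P x)) at h2
    rw [hx] at h2
    change (R * P * Q) ((Q * P) x) - x = _
    rw [h2]
    abel
  · refine LinearMap.FiniteRangeSetoid.equiv_iff_hasNoetherianRange.mpr (hfin _ _ _ ?_)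
    rintro ⟨x, hx⟩
    have hx := hQ.mem_range_iff.mp hx
    have h1 : (Q * P) * (R * P * Q) = (1 - R * N) * Q := by
      have h3 : Q * P * R = R * (Q * P) := by rw [mul_assoc, ← hRP, ← mul_assoc, ← hRQ, mul_assoc]
      rw [← hRD, mul_assoc R (1 - D), ← hQPQ, mul_assoc R, ← mul_assoc, h3, mul_assoc R, mul_assoc Q,
        ← mul_assoc P P, hPP]
    have h2 := congrArg (fun B : H →L[ℂ] H => B x) h1
    change (Q * P) ((R * P * Q) x) = Q x - R (N (Q x)) at h2
    rw [hx] at h2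
    change (Q * P) ((R * P * Q) x) - x = _
    rw [h2]
    abel

end Projections

/-! ### The index as a trace -/

/-- The trace formula in terms of the multiplicities of the eigenvalues `1` and `-1`. -/
theorem hasTrace_sub_pow {H : Type u} [NormedAddCommGroup H] [InnerProductSpace ℂ H]
    [CompleteSpace H] {P Q : H →L[ℂ] H} (hP : IsStarProjection P) (hQ : IsStarProjection Q) {k : ℕ}
    (hPQ : MemSchatten (2 * k + 1) (P - Q)) :
    HasTrace ((P - Q) ^ (2 * k + 1))
      (finrank ℂ (eigenspace ((P - Q : H →L[ℂ] H) : H →ₗ[ℂ] H) 1) -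
        finrank ℂ (eigenspace ((P - Q : H →L[ℂ] H) : H →ₗ[ℂ] H) (-1))) := by
  have hT : IsSelfAdjoint (P - Q) := hP.isSelfAdjoint.sub hQ.isSelfAdjoint
  have hc := hPQ.isCompactOperator hT
  refine ⟨hPQ.pow hT, fun κ b => ?_⟩
  obtain ⟨ι, e, he, hcard⟩ := exists_hilbertBasis_eigenvectors hT hc
  have hpow (A : H →L[ℂ] H) (x : H) (c : ℂ) (h : A x = c • x) (m : ℕ) :
      (A ^ m) x = c ^ m • x := by
    induction m with
    | zero => simp
    | succ m ih =>
      rw [pow_succ]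
      change (A ^ m) (A x) = _
      rw [h, map_smul, ih, smul_smul, pow_succ']
  have habs : Summable fun j : Σ μ, ι μ => ‖j.1 ^ (2 * k + 1)‖ := by
    refine (hPQ _ e).congr fun j => ?_
    rw [hpow _ _ _ (abs_apply_of_apply_eq_smul hT (he j)), inner_smul_right,
      inner_self_eq_norm_sq_to_K, e.orthonormal.1 j, norm_pow]
    simp [← Complex.ofReal_pow]
  have htr := e.hasSum_inner_apply_of_eigenbasis (fun j => hpow _ _ _ (he j) (2 * k + 1)) habs b
  -- Summing over the eigenbasis eigenvalue by eigenvalue.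
  have hsum : HasSum (fun μ : ℂ => (Nat.card (ι μ) : ℂ) * μ ^ (2 * k + 1))
      (∑' j : Σ μ, ι μ, j.1 ^ (2 * k + 1)) := by
    refine habs.of_norm.hasSum.sigma fun μ => ?_
    rcases eq_or_ne μ 0 with rfl | hμ
    · simp
    · have := (hcard μ hμ).1
      have := Fintype.ofFinite (ι μ)
      simpa [Nat.card_eq_fintype_card] using hasSum_fintype fun _ : ι μ => μ ^ (2 * k + 1)
  have hval := eq_sub_of_hasSum_mul_pow_odd (odd_two_mul_add_one k) hsum fun μ h0 h1 h2 => by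
    rw [(hcard _ (neg_ne_zero.mpr h0)).2, (hcard _ h0).2,
      finrank_eigenspace_sub_neg hP hQ hc h0 h1 h2]
  rwa [hval, (hcard _ one_ne_zero).2, (hcard _ (neg_ne_zero.mpr one_ne_zero)).2] at htr

theorem theorem2p3 {H : Type*} [NormedAddCommGroup H] [InnerProductSpace ℂ H] [CompleteSpace H]
    (P Q : H →L[ℂ] H) (hP : IsStarProjection P) (hQ : IsStarProjection Q)
    (k : ℕ) (hPQ : MemSchatten (2 * k + 1) (P - Q)) :
    (compressedProduct Q P).IsFredholm ∧
      HasTrace ((P - Q) ^ (2 * k + 1)) ((compressedProduct Q P).toLinearMap.index : ℂ) := by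
  have hF := isFredholm_compressedProduct hP hQ
    (hPQ.isCompactOperator (hP.isSelfAdjoint.sub hQ.isSelfAdjoint))
  refine ⟨hF, ?_⟩
  rw [LinearMap.index_eq_finrank_sub, finrank_ker_compressedProduct hP hQ,
    finrank_coker_compressedProduct hP hQ hF.isClosed_range]
  simpa using hasTrace_sub_pow hP hQ hPQ
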